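/- For integers $m\ge 1$ and $n\ge 0$ let $p_{m+2}(n)=m\binom n2+n=\frac{mn^2-(m-2)n}{2}$ be the $n$-th polygonal number of order $m+2$, and let $\mathbb N=\{0,1,2,\ldots\}$. Let $m\ge 3$ be an integer. Then every integer $N\ge 924m^3$ can be written as $$N=p_{m+2}(x_1)+p_{m+2}(x_2)+p_{m+2}(x_3)+3p_{m+2}(x_4)$$ with $x_1,x_2,x_3,x_4\in\mathbb N$. -/

import Mathlib

/-- `polygonal m n` is the `n`-th polygonal number of order `m + 2` (the `n`-th `(m + 2)`-gonal
number), written `p_{m+2}(n) = m * binom(n, 2) + n = (m n ^ 2 - (m - 2) n) / 2`. The first argument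
is the order minus two. -/
def polygonal (m n : ℕ) : ℕ := m * n.choose 2 + n

/-! With weights 1, 1, 1, 3, let a be the weighted sum of the squares of the x_i and b that of the
x_i. The claim becomes N = b + m(a - b)/2, so b ≡ N mod m determines a, with a ≡ b mod 2. Then 6a -
b² = (x₁+x₂+x₃-3x₄)² + (2x₁-x₂-x₃)² + 3(x₂-x₃)², and conversely a representation of 6a - b² by x² +
y² + 3z² yields integers x_i, nonnegative once 5a < b² + 2b + 6 (`exists_nonneg_of_representation`).
As a ≈ 2N/m, b must lie roughly between √(10N/m) and √(12N/m), an interval long enough when N is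
large against m³ to hold three terms of the class of N; one of them makes 6a - b² admissible.

Admissible values are represented (`sq_add_sq_add_three_sq`) by Dirichlet's method for three
squares: n is made a diagonal entry of a positive form of determinant 3, built from a prime in a
progression and quadratic reciprocity, and such forms fall into few classes. -/

/-! ### Positive ternary forms of determinant three -/

/-- The minor of a ternary symmetric matrix complementary to its last diagonal entry. -/
def leadingMinor (A : Matrix (Fin 3) (Fin 3) ℤ) : ℤ := A 0 0 * A 1 1 - A 0 1 ^ 2

/-- A symmetric integral ternary matrix of determinant three whose quadratic form is positive. -/
structure IsPosDetThree (A : Matrix (Fin 3) (Fin 3) ℤ) : Prop where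
  symm : A.transpose = A
  pos : ∀ v : Fin 3 → ℤ, v ≠ 0 → 0 < v ⬝ᵥ A.mulVec v
  det : A.det = 3

/-- Proper integral equivalence of ternary matrices. -/
def IntEquiv (A B : Matrix (Fin 3) (Fin 3) ℤ) : Prop :=
  ∃ V : Matrix (Fin 3) (Fin 3) ℤ, V.det = 1 ∧ B = V.transpose * A * V

theorem IntEquiv.refl (A : Matrix (Fin 3) (Fin 3) ℤ) : IntEquiv A A := ⟨1, by simp, by simp⟩

theorem IntEquiv.trans {A B C : Matrix (Fin 3) (Fin 3) ℤ} (h : IntEquiv A B) (h' : IntEquiv B C) :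
    IntEquiv A C := by
  obtain ⟨V, hV, rfl⟩ := h
  obtain ⟨W, hW, rfl⟩ := h'
  exact ⟨V * W, by simp [hV, hW], by simp [Matrix.mul_assoc]⟩

theorem IntEquiv.symm {A B : Matrix (Fin 3) (Fin 3) ℤ} (h : IntEquiv A B) : IntEquiv B A := by
  obtain ⟨V, hV, rfl⟩ := h
  have hu : IsUnit V.det := by simp [hV]
  refine ⟨V⁻¹, by simp [Matrix.det_nonsing_inv, hV], ?_⟩
  have h1 : V * V⁻¹ = 1 := Matrix.mul_nonsing_inv V hu
  have h2 : V⁻¹.transpose * V.transpose = 1 := by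
    rw [← Matrix.transpose_mul, h1, Matrix.transpose_one]
  calc A = (V⁻¹.transpose * V.transpose) * A * (V * V⁻¹) := by rw [h1, h2]; simp
    _ = _ := by simp only [Matrix.mul_assoc]

theorem IsPosDetThree.of_equiv {A B : Matrix (Fin 3) (Fin 3) ℤ} (hA : IsPosDetThree A)
    (h : IntEquiv A B) : IsPosDetThree B := by
  obtain ⟨V, hV, rfl⟩ := h
  refine ⟨?_, ?_, by simp [hV, hA.det]⟩
  · simp [Matrix.transpose_mul, hA.symm, Matrix.mul_assoc]
  · intro v hv
    have hne : V.mulVec v ≠ 0 := by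
      intro h0
      exact hv (Matrix.eq_zero_of_mulVec_eq_zero (by simp [hV]) h0)
    have := hA.pos _ hne
    have e : v ⬝ᵥ (V.transpose * A * V).mulVec v = V.mulVec v ⬝ᵥ A.mulVec (V.mulVec v) := by
      rw [Matrix.mul_assoc, ← Matrix.mulVec_mulVec, Matrix.dotProduct_mulVec,
        Matrix.vecMul_transpose, Matrix.mulVec_mulVec]
    rwa [e]

theorem IsPosDetThree.apply_comm {A : Matrix (Fin 3) (Fin 3) ℤ} (hA : IsPosDetThree A)
    (i j : Fin 3) : A i j = A j i := by
  conv_lhs => rw [← hA.symm, Matrix.transpose_apply]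

theorem IsPosDetThree.corner_pos {A : Matrix (Fin 3) (Fin 3) ℤ} (hA : IsPosDetThree A) :
    0 < A 0 0 := by
  have := hA.pos ![1, 0, 0] (fun h => by simpa using congrFun h 0)
  simpa [Matrix.mulVec, dotProduct, Fin.sum_univ_three] using this

theorem IsPosDetThree.leadingMinor_pos {A : Matrix (Fin 3) (Fin 3) ℤ} (hA : IsPosDetThree A) :
    0 < leadingMinor A := by
  have h0 := hA.corner_pos
  have := hA.pos ![-A 0 1, A 0 0, 0] (fun h => h0.ne' (by simpa using congrFun h 1))
  simp only [Matrix.mulVec, dotProduct, Fin.sum_univ_three, Matrix.cons_val_zero,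
    Matrix.cons_val_one, Matrix.cons_val, hA.apply_comm 1 0] at this
  refine pos_of_mul_pos_right (a := A 0 0) ?_ h0.le
  unfold leadingMinor
  linarith

theorem IsPosDetThree.det_eq {A : Matrix (Fin 3) (Fin 3) ℤ} (hA : IsPosDetThree A) :
    A 0 0 * A 1 1 * A 2 2 + 2 * A 0 1 * A 0 2 * A 1 2 - A 0 0 * A 1 2 ^ 2 - A 1 1 * A 0 2 ^ 2
      - A 2 2 * A 0 1 ^ 2 = 3 := by
  have h := hA.det
  rw [Matrix.det_fin_three, hA.apply_comm 1 0, hA.apply_comm 2 0, hA.apply_comm 2 1] at h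
  linarith

/-! ### Reduction and classification -/

/-- Every integer can be moved by a multiple of a positive `a` into `[-a/2, a/2]`. -/
theorem exists_centered_shift {a : ℤ} (ha : 0 < a) (x : ℤ) : ∃ k : ℤ, 2 * |x + a * k| ≤ a := by
  refine ⟨-((2 * x + a) / (2 * a)), ?_⟩
  have h1 := Int.emod_add_mul_ediv (2 * x + a) (2 * a)
  have h2 := Int.emod_nonneg (2 * x + a) (b := 2 * a) (by lia)
  have h3 := Int.emod_lt_of_pos (2 * x + a) (b := 2 * a) (by lia)
  have : |2 * (x + a * -((2 * x + a) / (2 * a)))| ≤ a := by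
    rw [abs_le]; constructor <;> linarith
  rwa [abs_mul, abs_two] at this

/-- A representative whose corner, and then leading minor, is smallest in its class. -/
theorem IsPosDetThree.exists_minimal {A : Matrix (Fin 3) (Fin 3) ℤ} (hA : IsPosDetThree A) :
    ∃ B, IntEquiv A B ∧ ∀ C, IntEquiv A C →
      B 0 0 ≤ C 0 0 ∧ (C 0 0 = B 0 0 → leadingMinor B ≤ leadingMinor C) := by
  let f : Matrix (Fin 3) (Fin 3) ℤ → ℕ ×ₗ ℕ :=
    fun C => toLex ((C 0 0).toNat, (leadingMinor C).toNat)
  obtain ⟨B, hB, hmin⟩ := (InvImage.wf f wellFounded_lt).has_min {C | IntEquiv A C}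
    ⟨A, IntEquiv.refl A⟩
  refine ⟨B, hB, fun C hC => ?_⟩
  have h := hmin C hC
  simp only [InvImage, f, Prod.Lex.toLex_lt_toLex, not_or, not_and, not_lt] at h
  have := (hA.of_equiv hB).corner_pos
  have := (hA.of_equiv hB).leadingMinor_pos
  have := (hA.of_equiv hC).corner_pos
  have := (hA.of_equiv hC).leadingMinor_pos
  exact ⟨by lia, fun e => by have := h.2 (by rw [e]); lia⟩

/-- A unipotent change of basis centres the off-diagonal data without altering the corner or leading
minor, so minimality survives; comparing with two basis exchanges gives the other inequalities. -/
theorem exists_reduced {A : Matrix (Fin 3) (Fin 3) ℤ} (hA : IsPosDetThree A) :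
    ∃ B, IntEquiv A B ∧ B 0 0 ≤ B 1 1 ∧ 2 * |B 0 1| ≤ B 0 0 ∧ 2 * |B 0 2| ≤ B 0 0 ∧
      leadingMinor B ≤ B 0 0 * B 2 2 - B 0 2 ^ 2 ∧
      2 * |B 0 0 * B 1 2 - B 0 1 * B 0 2| ≤ leadingMinor B := by
  obtain ⟨B, hB, hmin⟩ := hA.exists_minimal
  have hBp := hA.of_equiv hB
  obtain ⟨k, hk⟩ := exists_centered_shift hBp.leadingMinor_pos (B 0 0 * B 1 2 - B 0 1 * B 0 2)
  obtain ⟨i, hi⟩ := exists_centered_shift hBp.corner_pos (B 0 1)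
  obtain ⟨j, hj⟩ := exists_centered_shift hBp.corner_pos (B 0 2 + k * B 0 1)
  let V : Matrix (Fin 3) (Fin 3) ℤ := !![1, i, j; 0, 1, k; 0, 0, 1]
  let W : Matrix (Fin 3) (Fin 3) ℤ := !![0, -1, 0; 1, 0, 0; 0, 0, 1]
  let X : Matrix (Fin 3) (Fin 3) ℤ := !![1, 0, 0; 0, 0, -1; 0, 1, 0]
  have s10 := hBp.apply_comm 1 0
  have s20 := hBp.apply_comm 2 0
  have s21 := hBp.apply_comm 2 1
  set C := V.transpose * B * V with hC
  have hBC : IntEquiv B C := ⟨V, by simp [V, Matrix.det_fin_three], rfl⟩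
  have hAC := hB.trans hBC
  have hCp := hA.of_equiv hAC
  have t10 := hCp.apply_comm 1 0
  have t20 := hCp.apply_comm 2 0
  have t21 := hCp.apply_comm 2 1
  have c00 : C 0 0 = B 0 0 := by
    simp [hC, V, Matrix.mul_apply, Fin.sum_univ_three]
  have c01 : C 0 1 = B 0 1 + B 0 0 * i := by
    simp [hC, V, Matrix.mul_apply, Fin.sum_univ_three]; ring
  have c02 : C 0 2 = B 0 2 + k * B 0 1 + B 0 0 * j := by
    simp [hC, V, Matrix.mul_apply, Fin.sum_univ_three]; ring
  have c11 : C 1 1 = B 1 1 + 2 * i * B 0 1 + i ^ 2 * B 0 0 := by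
    simp [hC, V, Matrix.mul_apply, Fin.sum_univ_three, s10]; ring
  have c12 : C 1 2 = B 1 2 + k * B 1 1 + j * B 0 1 + i * (B 0 2 + k * B 0 1 + B 0 0 * j) := by
    simp [hC, V, Matrix.mul_apply, Fin.sum_univ_three, s10]; ring
  have cm : leadingMinor C = leadingMinor B := by
    unfold leadingMinor; rw [c00, c01, c11]; ring
  have cm' : C 0 0 * C 1 2 - C 0 1 * C 0 2 =
      B 0 0 * B 1 2 - B 0 1 * B 0 2 + leadingMinor B * k := by
    unfold leadingMinor; rw [c00, c01, c02, c12]; ring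
  refine ⟨C, hAC, ?_, by rw [c00, c01]; exact hi, by rw [c00, c02]; exact hj, ?_,
    by rw [cm, cm']; exact hk⟩
  · have := (hmin _ (hAC.trans ⟨W, by simp [W, Matrix.det_fin_three], rfl⟩)).1
    rw [c00]
    simpa [W, Matrix.mul_apply, Fin.sum_univ_three] using this
  · have := (hmin _ (hAC.trans ⟨X, by simp [X, Matrix.det_fin_three], rfl⟩)).2
      (by rw [← c00]; simp [X, Matrix.mul_apply, Fin.sum_univ_three])
    rw [cm]
    simpa [leadingMinor, X, Matrix.mul_apply, Fin.sum_univ_three] using this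

/-- Classification of positive ternary forms of determinant three. -/
theorem IsPosDetThree.classify {A : Matrix (Fin 3) (Fin 3) ℤ} (hA : IsPosDetThree A) :
    IntEquiv !![1, 0, 0; 0, 1, 0; 0, 0, 3] A ∨
      ∃ e : ℤ, e ^ 2 = 1 ∧ IntEquiv !![1, 0, 0; 0, 2, e; 0, e, 2] A := by
  obtain ⟨B, hAB, h1, h2, h3, h4, h5⟩ := exists_reduced hA
  have hBp := hA.of_equiv hAB
  have s10 := hBp.apply_comm 1 0
  have s20 := hBp.apply_comm 2 0
  have s21 := hBp.apply_comm 2 1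
  have hdet := hBp.det_eq
  have p0 := hBp.corner_pos
  have p1 := hBp.leadingMinor_pos
  set K := leadingMinor B with hK
  set E := B 0 0 * B 1 2 - B 0 1 * B 0 2
  -- Two-by-two minors of the adjugate are the determinant times entries. With the reduction bounds
  -- this gives K² ≤ 4α and 3α² ≤ 4K for the corner α, so 9α³ ≤ 64 and α = 1.
  have hKE : K * (B 0 0 * B 2 2 - B 0 2 ^ 2) = 3 * B 0 0 + E ^ 2 := by
    rw [← hdet, hK]; unfold leadingMinor; simp only [E]; ring
  have hE : 4 * E ^ 2 ≤ K ^ 2 := by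
    have := pow_le_pow_left₀ (by positivity) h5 2
    rwa [mul_pow, sq_abs, show (2 : ℤ) ^ 2 = 4 by norm_num] at this
  have hF : 4 * B 0 1 ^ 2 ≤ B 0 0 ^ 2 := by
    have := pow_le_pow_left₀ (by positivity) h2 2
    rwa [mul_pow, sq_abs, show (2 : ℤ) ^ 2 = 4 by norm_num] at this
  have hK2 : K ^ 2 ≤ 4 * B 0 0 := by nlinarith
  have ha : 3 * B 0 0 ^ 2 ≤ 4 * K := by
    have : K = B 0 0 * B 1 1 - B 0 1 ^ 2 := rfl
    nlinarith
  have hone : B 0 0 = 1 := by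
    by_contra hne
    have h2 : 2 ≤ B 0 0 := by lia
    have h6 : (3 * B 0 0 ^ 2) ^ 2 ≤ (4 * K) ^ 2 := pow_le_pow_left₀ (by positivity) ha 2
    have h7 : B 0 0 * (9 * B 0 0 ^ 3) ≤ B 0 0 * 64 := by nlinarith
    have h8 := le_of_mul_le_mul_left h7 p0
    have h9 : (2 : ℤ) ^ 3 ≤ B 0 0 ^ 3 := pow_le_pow_left₀ (by norm_num) h2 3
    linarith
  rw [hone] at h2 h3 h4 hK2
  have z1 : B 0 1 = 0 := abs_eq_zero.1 (by have := abs_nonneg (B 0 1); lia)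
  have z2 : B 0 2 = 0 := abs_eq_zero.1 (by have := abs_nonneg (B 0 2); lia)
  have hK11 : K = B 1 1 := by rw [hK]; unfold leadingMinor; rw [hone, z1]; ring
  have hE12 : E = B 1 2 := by simp only [E]; rw [hone, z1]; ring
  rw [hK11] at hK2 p1 h5
  rw [hE12] at h5
  rw [hone, z1, z2] at hdet
  have hB : B = !![1, 0, 0; 0, B 1 1, B 1 2; 0, B 1 2, B 2 2] := by
    ext i j
    fin_cases i <;> fin_cases j <;> simp [hone, z1, z2, s10, s20, s21]
  have hle : B 1 1 ≤ 2 := by nlinarith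
  obtain h | h : B 1 1 = 1 ∨ B 1 1 = 2 := by lia
  · left
    have z3 : B 1 2 = 0 := abs_eq_zero.1 (by have := abs_nonneg (B 1 2); lia)
    have z4 : B 2 2 = 3 := by rw [h, z3] at hdet; lia
    rw [h, z3, z4] at hB
    rw [← hB]; exact hAB.symm
  · right
    have hr : |B 1 2| ≤ 1 := by lia
    rw [abs_le] at hr
    have he : B 1 2 ≠ 0 := by
      intro h0; rw [h, h0] at hdet; lia
    have hs : B 1 2 ^ 2 = 1 := by
      obtain h | h : B 1 2 = 1 ∨ B 1 2 = -1 := by lia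
      all_goals rw [h]; norm_num
    have z4 : B 2 2 = 2 := by rw [h, hs] at hdet; lia
    refine ⟨B 1 2, hs, ?_⟩
    rw [h, z4] at hB
    rw [← hB]; exact hAB.symm

/-- In the second class the leading minor is a value of the adjugate form, which is twice a square
modulo 3, never 1. So the form is equivalent to x² + y² + 3z². -/
theorem sq_add_sq_add_three_sq_of_form {A : Matrix (Fin 3) (Fin 3) ℤ} (hA : IsPosDetThree A)
    (hm : leadingMinor A % 3 = 1) : ∃ x y z : ℤ, A 2 2 = x ^ 2 + y ^ 2 + 3 * z ^ 2 := by
  obtain ⟨V, -, rfl⟩ | ⟨e, he, V, -, rfl⟩ := hA.classify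
  · exact ⟨V 0 2, V 1 2, V 2 2, by simp [Matrix.mul_apply, Fin.sum_univ_three]; ring⟩
  · exfalso
    set w : ℤ := V 0 0 * V 2 1 - V 2 0 * V 0 1
    set w' : ℤ := V 0 0 * V 1 1 - V 1 0 * V 0 1
    have key : leadingMinor (V.transpose * !![1, 0, 0; 0, 2, e; 0, e, 2] * V) =
        3 * (V 1 0 * V 2 1 - V 2 0 * V 1 1) ^ 2 + 2 * (w - e * w') ^ 2 + 6 * e * (w * w') := by
      simp only [leadingMinor, w, w', Matrix.mul_apply, Fin.sum_univ_three,
        Matrix.transpose_apply, Matrix.of_apply, Matrix.cons_val', Matrix.cons_val_zero,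
        Matrix.cons_val_one, Matrix.cons_val]
      linear_combination (-(V 1 0 * V 2 1 - V 2 0 * V 1 1) ^ 2
        - 2 * (V 0 0 * V 1 1 - V 1 0 * V 0 1) ^ 2) * he
    rw [key] at hm
    generalize (V 1 0 * V 2 1 - V 2 0 * V 1 1) ^ 2 = u at hm
    generalize w - e * w' = x at hm
    have h6 : (2 * x ^ 2) % 3 = 1 := by
      rw [show 3 * u + 2 * x ^ 2 + 6 * e * (w * w') = 2 * x ^ 2 + 3 * (u + 2 * e * (w * w')) by ring,
        Int.add_mul_emod_self_left] at hm
      exact hm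
    have : x % 3 = 0 ∨ x % 3 = 1 ∨ x % 3 = 2 := by lia
    rcases this with h | h | h <;> simp [Int.mul_emod, pow_two, h] at h6

/-! ### Numbers of the form x² + y² + 3z² -/

open scoped NumberTheorySymbols

theorem jacobiSym_neg_three {b : ℕ} (hb4 : b % 4 = 3) (hb3 : b % 3 = 1) : J(-3 | b) = 1 := by
  have hodd : Odd b := Nat.odd_iff.2 (by lia)
  have h1 : J(-1 | b) = -1 := by
    rw [jacobiSym.at_neg_one hodd, ZMod.χ₄_nat_three_mod_four hb4]
  have h3 : J(((3 : ℕ) : ℤ) | b) = -1 := by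
    rw [jacobiSym.quadratic_reciprocity_three_mod_four (by norm_num) hb4, jacobiSym.mod_left,
      show (b : ℤ) % (3 : ℕ) = 1 by lia, jacobiSym.one_left]
  have : (-3 : ℤ) = -1 * ((3 : ℕ) : ℤ) := by norm_num
  rw [this, jacobiSym.mul_left, h1, h3]
  norm_num

theorem jacobiSym_neg_of_three_mod_four {b p : ℕ} (hp : Odd p) (hb4 : b % 4 = 3) :
    J(-b | p) = J(p | b) := by
  rw [neg_eq_neg_one_mul, jacobiSym.mul_left, jacobiSym.at_neg_one hp]
  have := Nat.odd_iff.1 hp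
  obtain h | h : p % 4 = 1 ∨ p % 4 = 3 := by lia
  · rw [ZMod.χ₄_nat_one_mod_four h, one_mul]
    exact (jacobiSym.quadratic_reciprocity_one_mod_four h (Nat.odd_iff.2 (by lia))).symm
  · rw [ZMod.χ₄_nat_three_mod_four h,
      jacobiSym.quadratic_reciprocity_three_mod_four hb4 h]
    ring

/-- If `c p ≡ -3` modulo `b`, where `c` has trivial symbol, then `-b` is a square modulo `4 p`. -/
theorem exists_four_mul_prime_dvd_sq_add {b p c n : ℕ} (hp : p.Prime) (hp2 : 2 < p)
    (hb4 : b % 4 = 3) (hb3 : b % 3 = 1) (hrel : c * p + 3 = n * b) (hc : J(c | b) = 1) :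
    ∃ t : ℤ, (4 * p : ℤ) ∣ t ^ 2 + b := by
  have : Fact p.Prime := ⟨hp⟩
  have hodd : Odd p := hp.odd_of_ne_two (by lia)
  have hJ : J(p | b) = 1 := by
    have h1 : J((c : ℤ) * p | b) = 1 := by
      rw [← jacobiSym_neg_three hb4 hb3]
      apply jacobiSym.mod_left'
      have hz : (c : ℤ) * p + 3 = n * b := by exact_mod_cast hrel
      rw [show (c : ℤ) * p = -3 + b * n by linarith, Int.add_mul_emod_self_left]
    rwa [jacobiSym.mul_left, hc, one_mul] at h1
  rw [← jacobiSym_neg_of_three_mod_four hodd hb4] at hJ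
  obtain ⟨y, hy⟩ := ZMod.isSquare_of_jacobiSym_eq_one hJ
  obtain ⟨t, rfl⟩ := ZMod.intCast_surjective y
  have hdvd : (p : ℤ) ∣ t ^ 2 + b := by
    rw [← ZMod.intCast_zmod_eq_zero_iff_dvd]
    push_cast at hy ⊢
    linear_combination -hy
  have hcop : IsCoprime (4 : ℤ) (p : ℤ) := by
    rw [show (4 : ℤ) = 2 ^ 2 by norm_num]
    apply IsCoprime.pow_left
    exact_mod_cast (Nat.coprime_two_left.2 hodd).isCoprime
  have four : ∀ u : ℤ, Odd u → (4 : ℤ) ∣ u ^ 2 + b := by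
    rintro u ⟨k, rfl⟩
    obtain ⟨l, hl⟩ : ∃ l : ℕ, b = 4 * l + 3 := ⟨b / 4, by lia⟩
    exact ⟨k ^ 2 + k + l + 1, by rw [hl]; push_cast; ring⟩
  -- Adding the odd p makes the root odd, and then 4 divides since b ≡ 3 mod 4.
  obtain ht | ht := Int.even_or_odd t
  · refine ⟨t + p, hcop.mul_dvd (four _ (ht.add_odd (by exact_mod_cast hodd))) ?_⟩
    rw [show (t + p) ^ 2 + b = (t ^ 2 + b) + (p : ℤ) * (2 * t + p) by ring]
    exact dvd_add hdvd (dvd_mul_right _ _)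
  · exact ⟨t, hcop.mul_dvd (four _ ht) hdvd⟩

/-- The leading minor is b and the determinant is nb - s²q = 3; positivity follows by completing
squares after scaling by bq. -/
theorem isPosDetThree_of_minor {a t q s n b : ℤ} (hq : 0 < q) (hb : 0 < b)
    (h1 : a * q = t ^ 2 + b) (h2 : s ^ 2 * q + 3 = n * b) :
    IsPosDetThree !![a, t, s; t, q, 0; s, 0, n] := by
  refine ⟨?_, ?_, ?_⟩
  · ext i j; fin_cases i <;> fin_cases j <;> rfl
  · intro v hv
    by_contra! hle
    have key : b * q * (v ⬝ᵥ (!![a, t, s; t, q, 0; s, 0, n]).mulVec v) =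
        b * (q * v 1 + t * v 0) ^ 2 + (b * v 0 + s * q * v 2) ^ 2 + 3 * q * v 2 ^ 2 := by
      simp [Matrix.mulVec, dotProduct, Fin.sum_univ_three]
      linear_combination (b * v 0 ^ 2) * h1 - q * v 2 ^ 2 * h2
    have hle' := mul_nonpos_of_nonneg_of_nonpos (mul_pos hb hq).le hle
    rw [key] at hle'
    have i1 : 0 ≤ b * (q * v 1 + t * v 0) ^ 2 := by positivity
    have i2 : 0 ≤ (b * v 0 + s * q * v 2) ^ 2 := by positivity
    have i3 : 0 ≤ 3 * q * v 2 ^ 2 := by positivity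
    have z2 : v 2 = 0 := by
      have : 3 * q * v 2 ^ 2 = 0 := by linarith
      simpa [hq.ne'] using this
    have z0 : v 0 = 0 := by
      have : (b * v 0 + s * q * v 2) ^ 2 = 0 := by linarith
      simpa [z2, hb.ne'] using this
    have z1 : v 1 = 0 := by
      have : b * (q * v 1 + t * v 0) ^ 2 = 0 := by linarith
      simpa [z0, hb.ne', hq.ne'] using this
    apply hv
    ext i; fin_cases i <;> assumption
  · simp [Matrix.det_fin_three]
    linear_combination n * h1 - h2

theorem sq_add_sq_add_three_sq_of_prime {n s g b p : ℕ} (hp : p.Prime) (hp2 : 2 < p)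
    (hg : g ∣ 4) (hb4 : b % 4 = 3) (hb3 : b % 3 = 1) (hrel : s ^ 2 * g * p + 3 = n * b)
    (hJ : J(((s ^ 2 * g : ℕ) : ℤ) | b) = 1) : ∃ x y z : ℤ, (n : ℤ) = x ^ 2 + y ^ 2 + 3 * z ^ 2 := by
  obtain ⟨t, ht⟩ := exists_four_mul_prime_dvd_sq_add hp hp2 hb4 hb3 hrel hJ
  have hgp : ((g * p : ℕ) : ℤ) ∣ t ^ 2 + b := by
    refine dvd_trans ?_ ht
    exact_mod_cast mul_dvd_mul_right hg p
  obtain ⟨a, ha⟩ := hgp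
  have hg0 : 0 < g := Nat.pos_of_dvd_of_pos hg (by norm_num)
  have hA : IsPosDetThree !![a, t, (s : ℤ); t, ((g * p : ℕ) : ℤ), 0; (s : ℤ), 0, (n : ℤ)] := by
    refine isPosDetThree_of_minor (b := b) ?_ (by lia) (by rw [ha]; ring) ?_
    · exact_mod_cast Nat.mul_pos hg0 hp.pos
    · exact_mod_cast (by rw [← hrel]; ring : s ^ 2 * (g * p) + 3 = n * b)
  refine sq_add_sq_add_three_sq_of_form hA ?_
  have : leadingMinor !![a, t, (s : ℤ); t, ((g * p : ℕ) : ℤ), 0; (s : ℤ), 0, (n : ℤ)] = b := by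
    simp only [leadingMinor, Matrix.of_apply, Matrix.cons_val', Matrix.cons_val_zero,
      Matrix.cons_val_one]
    linear_combination -ha
  rw [this]; lia

/-- Dirichlet's theorem along a linear relation between a prime and a residue modulo 24. -/
theorem exists_prime_of_linear_relation {n u c M r : ℕ} (hM : M ≠ 0) (hc : c.Coprime M)
    (h1 : u * c + 3 = n * r) (h2 : u * M = 24 * n) :
    ∃ p k : ℕ, p.Prime ∧ 2 < p ∧ u * p + 3 = n * (24 * k + r) := by
  obtain ⟨p, hgt, hp, hmod⟩ := Nat.forall_exists_prime_gt_and_modEq (max c 2) hM hc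
  obtain ⟨k, hk⟩ := (Nat.modEq_iff_dvd' (by lia)).1 hmod.symm
  refine ⟨p, k, hp, by lia, ?_⟩
  have : p = c + M * k := by lia
  rw [this]
  linear_combination h1 + k * h2

/-- The two-adic data attached to an integer not divisible by four. -/
theorem exists_two_adic_data {n : ℕ} (hn : n % 4 ≠ 0) : ∃ g r c : ℕ, g ∣ 4 ∧ r % 12 = 7 ∧
    g * c + 3 = n * r ∧ c % 2 = 1 ∧ ∀ k, J((g : ℤ) | 24 * k + r) = 1 := by
  have h4 : ∀ r k : ℕ, r % 12 = 7 → J(((4 : ℕ) : ℤ) | 24 * k + r) = 1 := fun r k hr =>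
    jacobiSym.at_four (Nat.odd_iff.2 (by lia))
  -- g is the exact power of 2 in nr - 3. Only n ≡ 5 mod 8 needs r = 19, since there 8 divides 7n -
  -- 3.
  obtain h | h | h | h : n % 4 = 2 ∨ n % 4 = 3 ∨ n % 8 = 1 ∨ n % 8 = 5 := by lia
  · exact ⟨1, 7, n * 7 - 3, by norm_num, by norm_num, by lia, by lia,
      fun k => by simp⟩
  · refine ⟨2, 7, (n * 7 - 3) / 2, by norm_num, by norm_num, by lia, by lia, fun k => ?_⟩
    have hodd : Odd (24 * k + 7) := Nat.odd_iff.2 (by lia)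
    rw [Nat.cast_ofNat, jacobiSym.at_two hodd, ZMod.χ₈_nat_eq_if_mod_eight]
    simp [show (24 * k + 7) % 2 = 1 by lia, show (24 * k + 7) % 8 = 7 by lia]
  · exact ⟨4, 7, (n * 7 - 3) / 4, by norm_num, by norm_num, by lia, by lia,
      fun k => h4 7 k (by norm_num)⟩
  · exact ⟨4, 19, (n * 19 - 3) / 4, by norm_num, by norm_num, by lia, by lia,
      fun k => h4 19 k (by norm_num)⟩

theorem sq_add_sq_add_three_sq_of_two_mod_three {n : ℕ} (hn : n % 4 ≠ 0) (h3 : n % 3 = 2) :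
    ∃ x y z : ℤ, (n : ℤ) = x ^ 2 + y ^ 2 + 3 * z ^ 2 := by
  obtain ⟨g, r, c, hg, hr, hc, hc2, hJ⟩ := exists_two_adic_data hn
  obtain ⟨h, hgh⟩ := hg
  have hh : h ∣ 4 := ⟨g, by rw [hgh]; ring⟩
  have c3 : ¬ 3 ∣ c := by
    intro hd
    have h0 : (n * r) % 3 = 0 := by rw [← hc]; have := hd.mul_left g; lia
    rw [Nat.mul_mod, h3, show r % 3 = 1 by lia] at h0
    lia
  have cop3 : c.Coprime 3 := ((Nat.prime_three.coprime_iff_not_dvd).2 c3).symm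
  have cop2 : c.Coprime 4 := by
    rw [show 4 = 2 ^ 2 by norm_num]
    exact (Nat.coprime_two_right.2 (Nat.odd_iff.2 hc2)).pow_right 2
  have copn : c.Coprime n := by
    have hd : Nat.gcd c n ∣ 3 := by
      have e : Nat.gcd c n ∣ g * c + 3 := by rw [hc]; exact (Nat.gcd_dvd_right _ _).mul_right _
      exact (Nat.dvd_add_right ((Nat.gcd_dvd_left _ _).mul_left _)).1 e
    rcases (Nat.dvd_prime Nat.prime_three).1 hd with h | h
    · exact h
    · exact absurd (h ▸ Nat.gcd_dvd_left c n) c3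
  have cop : c.Coprime (2 * 3 * h * n) :=
    ((((cop2.coprime_dvd_right (by norm_num)).mul_right cop3).mul_right
      (cop2.coprime_dvd_right hh)).mul_right copn)
  obtain ⟨p, k, hp, hp2, hrel⟩ := exists_prime_of_linear_relation (n := n) (u := g) (r := r)
    (by rintro h0; simp at h0; rcases h0 with rfl | rfl <;> simp_all) cop hc
    (by calc g * (2 * 3 * h * n) = g * h * (6 * n) := by ring
      _ = 24 * n := by rw [← hgh]; ring)
  exact sq_add_sq_add_three_sq_of_prime (s := 1) hp hp2 ⟨h, hgh⟩ (b := 24 * k + r) (by lia) (by lia)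
    (by linarith) (by simpa using hJ k)

theorem sq_add_sq_add_three_sq_of_three_mod_nine {n : ℕ} (hn : n % 4 ≠ 0) (h9 : n % 9 = 3) :
    ∃ x y z : ℤ, (n : ℤ) = x ^ 2 + y ^ 2 + 3 * z ^ 2 := by
  obtain ⟨g, r, c, hg, hr, hc, hc2, hJ⟩ := exists_two_adic_data hn
  obtain ⟨h, hgh⟩ := id hg
  have hh : h ∣ 4 := ⟨g, by rw [hgh]; ring⟩
  obtain ⟨l, rfl⟩ : ∃ l, n = 9 * l + 3 := ⟨n / 9, by lia⟩
  obtain ⟨j, rfl⟩ : ∃ j, r = 3 * j + 1 := ⟨r / 3, by lia⟩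
  -- Here c is divisible by 9; this square moves into s = 3, leaving a cofactor to which Dirichlet
  -- applies.
  have hd : 9 ∣ g * c := ⟨3 * l * j + l + j, by linear_combination hc⟩
  have hg9 : Nat.Coprime 9 g := Nat.Coprime.coprime_dvd_right hg (by norm_num)
  obtain ⟨d, rfl⟩ := hg9.dvd_of_dvd_mul_left hd
  have hrel' : 3 * g * d + 1 = (3 * l + 1) * (3 * j + 1) := by linarith
  have cop2 : d.Coprime 4 := by
    rw [show 4 = 2 ^ 2 by norm_num]
    exact (Nat.coprime_two_right.2 (Nat.odd_iff.2 (by lia))).pow_right 2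
  have copn : d.Coprime (3 * l + 1) := by
    have hd : Nat.gcd d (3 * l + 1) ∣ 1 := by
      have e : Nat.gcd d (3 * l + 1) ∣ 3 * g * d + 1 := by
        rw [hrel']; exact (Nat.gcd_dvd_right _ _).mul_right _
      exact (Nat.dvd_add_right ((Nat.gcd_dvd_left _ _).mul_left _)).1 e
    exact Nat.dvd_one.1 hd
  have cop : d.Coprime (2 * h * (3 * l + 1)) :=
    ((cop2.coprime_dvd_right (by norm_num)).mul_right (cop2.coprime_dvd_right hh)).mul_right copn
  obtain ⟨p, k, hp, hp2, hrel⟩ := exists_prime_of_linear_relation (n := 9 * l + 3) (u := 3 ^ 2 * g)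
    (r := 3 * j + 1)
    (by rintro h0; simp at h0; subst h0; simp at hgh) cop (by rw [← hc]; ring)
    (by calc 3 ^ 2 * g * (2 * h * (3 * l + 1)) = g * h * (18 * (3 * l + 1)) := by ring
      _ = 24 * (9 * l + 3) := by rw [← hgh]; ring)
  refine sq_add_sq_add_three_sq_of_prime (s := 3) hp hp2 hg (b := 24 * k + (3 * j + 1)) (by lia)
    (by lia) hrel ?_
  rw [Nat.cast_mul, jacobiSym.mul_left, hJ k, Nat.cast_pow, jacobiSym.sq_one', one_mul]
  rw [Int.gcd_natCast_natCast]
  exact (Nat.prime_three.coprime_iff_not_dvd).2 (by lia)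

/-- Integers congruent to `2` modulo `3` or to `3` modulo `9` have the form `x² + y² + 3z²`. -/
theorem sq_add_sq_add_three_sq {n : ℕ} (h : n % 3 = 2 ∨ n % 9 = 3) :
    ∃ x y z : ℤ, (n : ℤ) = x ^ 2 + y ^ 2 + 3 * z ^ 2 := by
  induction n using Nat.strong_induction_on with
  | _ n ih =>
    by_cases h4 : n % 4 = 0
    -- Division by 4 preserves both residue conditions.
    · obtain ⟨x, y, z, hx⟩ := ih (n / 4) (by lia) (by lia)
      refine ⟨2 * x, 2 * y, 2 * z, ?_⟩
      have : (n : ℤ) = 4 * (n / 4 : ℕ) := by lia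
      rw [this, hx]; ring
    · rcases h with h | h
      · exact sq_add_sq_add_three_sq_of_two_mod_three h4 h
      · exact sq_add_sq_add_three_sq_of_three_mod_nine h4 h

/-! ### The analogue of Cauchy's lemma -/

theorem Int.sq_emod_four_eq (x : ℤ) : x ^ 2 % 4 = x % 2 := by
  obtain h | h := Int.emod_two_eq_zero_or_one x
  · obtain ⟨k, rfl⟩ : ∃ k, x = 2 * k := ⟨x / 2, by lia⟩
    rw [show (2 * k) ^ 2 = 4 * k ^ 2 by ring]; lia
  · obtain ⟨k, rfl⟩ : ∃ k, x = 2 * k + 1 := ⟨x / 2, by lia⟩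
    rw [show (2 * k + 1) ^ 2 = 4 * (k ^ 2 + k) + 1 by ring]; lia

theorem Int.emod_three_sq_cases (x : ℤ) :
    x % 3 = 0 ∧ x ^ 2 % 3 = 0 ∨ (x % 3 = 1 ∨ x % 3 = 2) ∧ x ^ 2 % 3 = 1 := by
  obtain h | h | h : x % 3 = 0 ∨ x % 3 = 1 ∨ x % 3 = 2 := by lia
  all_goals simp [pow_two, Int.mul_emod, h]

/-- A representation of `6a - b²` by `x² + y² + 3z²` can be normalised modulo `6`. -/
theorem exists_normalized_representation {a b x y z : ℤ} (hpar : (a - b) % 2 = 0)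
    (h : 6 * a - b ^ 2 = x ^ 2 + y ^ 2 + 3 * z ^ 2) :
    ∃ x y z : ℤ, 6 * a - b ^ 2 = x ^ 2 + y ^ 2 + 3 * z ^ 2 ∧
      (b - x) % 6 = 0 ∧ (y - z) % 2 = 0 ∧ (y + b) % 3 = 0 := by
  have sx := Int.sq_emod_four_eq x
  have sy := Int.sq_emod_four_eq y
  have sz := Int.sq_emod_four_eq z
  have sb := Int.sq_emod_four_eq b
  have swap : ∃ x y : ℤ, 6 * a - b ^ 2 = x ^ 2 + y ^ 2 + 3 * z ^ 2 ∧
      (b - x) % 2 = 0 ∧ (y - z) % 2 = 0 := by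
    -- Modulo 4, a ≡ b mod 2 gives x² + y² ≡ b² + z², so the parities of x, y are those of b, z in
    -- some order.
    have : (b - x) % 2 = 0 ∧ (y - z) % 2 = 0 ∨ (b - y) % 2 = 0 ∧ (x - z) % 2 = 0 := by lia
    obtain h' | h' := this
    · exact ⟨x, y, h, h'⟩
    · exact ⟨y, x, by rw [h]; ring, h'⟩
  clear h sx sy
  obtain ⟨x, y, h, hx, hy⟩ := swap
  have tx := Int.emod_three_sq_cases x
  have ty := Int.emod_three_sq_cases y
  have tb := Int.emod_three_sq_cases b
  -- Modulo 3, x² + y² + b² ≡ 0, so all three vanish or none does.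
  have hx3 : (b - x) % 3 = 0 ∨ (b + x) % 3 = 0 := by lia
  have hy3 : (y + b) % 3 = 0 ∨ (-y + b) % 3 = 0 := by lia
  obtain ⟨x', hx', hx2, hx3⟩ : ∃ x', x' ^ 2 = x ^ 2 ∧ (b - x') % 2 = 0 ∧ (b - x') % 3 = 0 := by
    obtain h' | h' := hx3
    · exact ⟨x, rfl, hx, h'⟩
    · exact ⟨-x, by ring, by lia, by lia⟩
  obtain ⟨y', hy', hy2, hy3⟩ : ∃ y', y' ^ 2 = y ^ 2 ∧ (y' - z) % 2 = 0 ∧ (y' + b) % 3 = 0 := by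
    obtain h' | h' := hy3
    · exact ⟨y, rfl, hy, h'⟩
    · exact ⟨-y, by ring, by lia, h'⟩
  exact ⟨x', y', z, by rw [hx', hy', h], by lia, hy2, hy3⟩

/-- An analogue of Cauchy's lemma for the weights `1, 1, 1, 3`. -/
theorem exists_nonneg_of_representation {a b x y z : ℤ} (hb : 0 ≤ b) (hpar : (a - b) % 2 = 0)
    (h : 6 * a - b ^ 2 = x ^ 2 + y ^ 2 + 3 * z ^ 2) (h5 : 5 * a < b ^ 2 + 2 * b + 6) :
    ∃ x₁ x₂ x₃ x₄ : ℤ, 0 ≤ x₁ ∧ 0 ≤ x₂ ∧ 0 ≤ x₃ ∧ 0 ≤ x₄ ∧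
      a = x₁ ^ 2 + x₂ ^ 2 + x₃ ^ 2 + 3 * x₄ ^ 2 ∧ b = x₁ + x₂ + x₃ + 3 * x₄ := by
  obtain ⟨x, y, z, h, hx, hy, hyb⟩ := exists_normalized_representation hpar h
  obtain ⟨t, rfl⟩ : ∃ t, x = b - 6 * t := ⟨(b - x) / 6, by lia⟩
  obtain ⟨u, rfl⟩ : ∃ u, y = z + 2 * u := ⟨(y - z) / 2, by lia⟩
  obtain ⟨w, rfl⟩ : ∃ w, b = 3 * w + u + 2 * z + 3 * t := ⟨(b - 3 * t - u - 2 * z) / 3, by lia⟩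
  -- Cauchy–Schwarz on the other variables (total weight 5) gives 5a ≥ (b - p)² + 5p², at least b² +
  -- 2b + 6 if p ≤ -1.
  have nonneg : ∀ p q r s : ℤ, a = p ^ 2 + q ^ 2 + r ^ 2 + 3 * s ^ 2 →
      3 * w + u + 2 * z + 3 * t = p + q + r + 3 * s → 0 ≤ p := by
    intro p q r s ha hsum
    by_contra! hp
    rw [hsum] at h5 hb
    nlinarith [sq_nonneg (q - r), sq_nonneg (q - s), sq_nonneg (r - s),
      mul_nonneg (show 0 ≤ -1 - p by lia) hb, mul_nonneg (show 0 ≤ -1 - p by lia)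
      (show 0 ≤ -1 - p by lia)]
  have nonneg' : ∀ p q r s : ℤ, a = p ^ 2 + q ^ 2 + r ^ 2 + 3 * s ^ 2 →
      3 * w + u + 2 * z + 3 * t = p + q + r + 3 * s → 0 ≤ s := by
    intro p q r s ha hsum
    by_contra! hp
    rw [hsum] at h5 hb
    nlinarith [sq_nonneg (p - q), sq_nonneg (p - r), sq_nonneg (q - r), sq_nonneg p, sq_nonneg q,
      sq_nonneg r, sq_nonneg s,
      mul_nonneg (show 0 ≤ -1 - s by lia) hb, mul_nonneg (show 0 ≤ -1 - s by lia)
      (show 0 ≤ -1 - s by lia)]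
  have ha : a = (w + u + z) ^ 2 + (w + z) ^ 2 + w ^ 2 + 3 * t ^ 2 := by
    have : 6 * a = 6 * ((w + u + z) ^ 2 + (w + z) ^ 2 + w ^ 2 + 3 * t ^ 2) := by
      linear_combination h
    lia
  exact ⟨w + u + z, w + z, w, t, nonneg _ _ _ _ ha (by ring),
    nonneg (w + z) w (w + u + z) t (by rw [ha]; ring) (by ring),
    nonneg w (w + z) (w + u + z) t (by rw [ha]; ring) (by ring),
    nonneg' _ _ _ _ ha (by ring), ha, by ring⟩

/-! ### Choice of a and b -/

theorem two_mul_polygonal (m n : ℕ) :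
    2 * (polygonal m n : ℤ) = m * ((n : ℤ) ^ 2 - n) + 2 * n := by
  have h : 2 * (n.choose 2 : ℤ) = (n : ℤ) ^ 2 - n := by
    cases n with
    | zero => simp
    | succ k =>
      rw [Nat.choose_two_right]
      have h2 := Nat.div_mul_cancel (Nat.even_mul_pred_self (k + 1)).two_dvd
      zify at h2
      simp only [Nat.add_sub_cancel] at h2 ⊢
      push_cast at h2 ⊢
      linear_combination h2
  unfold polygonal
  push_cast
  linear_combination (m : ℤ) * h

/-- Among three consecutive terms of a residue class one gives an admissible ternary value. -/
theorem exists_admissible_shift (m b q : ℤ) : ∃ j : ℤ, 0 ≤ j ∧ j ≤ 2 ∧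
    ((6 * (b + j * m + 2 * (q - j)) - (b + j * m) ^ 2) % 3 = 2 ∨
      (6 * (b + j * m + 2 * (q - j)) - (b + j * m) ^ 2) % 9 = 3) := by
  by_cases h : b % 3 = 0 ∧ m % 3 = 0
  · obtain ⟨c, rfl⟩ : ∃ c, b = 3 * c := ⟨b / 3, by lia⟩
    obtain ⟨k, rfl⟩ : ∃ k, m = 3 * k := ⟨m / 3, by lia⟩
    -- Modulo 9 the value is 3(q - j), so j ≡ q - 1 mod 3 is needed.
    refine ⟨(2 + q) % 3, by lia, by lia, Or.inr ?_⟩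
    generalize hj : (2 + q) % 3 = j
    have : (3 * c + j * (3 * k)) ^ 2 = 9 * (c + j * k) ^ 2 := by ring
    rw [this, show j * (3 * k) = 3 * (j * k) by ring]
    lia
  · have : b % 3 ≠ 0 ∨ (b + m) % 3 ≠ 0 := by lia
    obtain h' | h' := this
    · have := Int.emod_three_sq_cases b
      exact ⟨0, by lia, by lia, Or.inl (by simp only [zero_mul, add_zero]; lia)⟩
    · have := Int.emod_three_sq_cases (b + m)
      exact ⟨1, by lia, by lia, Or.inl (by simp only [one_mul]; lia)⟩

theorem theorem1p3 (m : ℕ) (hm : 3 ≤ m) (N : ℕ) (hN : 924 * m ^ 3 ≤ N) :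
    ∃ x₁ x₂ x₃ x₄ : ℕ,
      N = polygonal m x₁ + polygonal m x₂ + polygonal m x₃ + 3 * polygonal m x₄ := by
  set S := Nat.sqrt (10 * N / m) with hS
  have hm0 : 0 < m := by lia
  have hS1 : S ^ 2 * m ≤ 10 * N := by
    have := Nat.sqrt_le' (10 * N / m)
    exact (Nat.le_div_iff_mul_le hm0).1 this
  have hS2 : 10 * N < (S + 1) ^ 2 * m := by
    have := Nat.lt_succ_sqrt' (10 * N / m)
    exact (Nat.div_lt_iff_lt_mul hm0).1 this
  obtain ⟨b₀, q, hb1, hb2, hq⟩ : ∃ b₀ q : ℤ, (S : ℤ) + 4 ≤ b₀ ∧ b₀ < S + 4 + m ∧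
      (N : ℤ) = b₀ + m * q := by
    refine ⟨S + 4 + ((N : ℤ) - (S + 4)) % m, ((N : ℤ) - (S + 4)) / m, ?_, ?_, ?_⟩
    · have := Int.emod_nonneg ((N : ℤ) - (S + 4)) (b := m) (by lia)
      lia
    · have := Int.emod_lt_of_pos ((N : ℤ) - (S + 4)) (b := m) (by lia)
      lia
    · have := Int.emod_add_mul_ediv ((N : ℤ) - (S + 4)) m
      lia
  obtain ⟨j, hj0, hj2, hadm⟩ := exists_admissible_shift m b₀ q
  obtain ⟨b, hb⟩ : ∃ b, b = b₀ + j * m := ⟨_, rfl⟩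
  obtain ⟨a, ha⟩ : ∃ a, a = b + 2 * (q - j) := ⟨_, rfl⟩
  rw [← hb, ← ha] at hadm
  have hm' : (3 : ℤ) ≤ m := by exact_mod_cast hm
  have hN' : 924 * (m : ℤ) ^ 3 ≤ N := by exact_mod_cast hN
  zify at hS1 hS2
  have hbl : (S : ℤ) + 4 ≤ b := by rw [hb]; nlinarith
  have hbu : b ≤ S + (3 * m + 4) := by rw [hb]; nlinarith
  have hma : (m : ℤ) * a = m * b + 2 * (N - b) := by rw [ha, hq, hb]; ring
  have hbm : b ^ 2 * m ≤ 12 * N := by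
    -- The error from b - S is absorbed by the gap between 10N and 12N, using N ≥ 924m³.
    have h1 : b ^ 2 ≤ (S + (3 * m + 4)) ^ 2 := pow_le_pow_left₀ (by lia) hbu 2
    have h2 : 10 * ((S : ℤ) + (3 * m + 4)) ^ 2 ≤ 11 * S ^ 2 + 110 * (3 * m + 4) ^ 2 := by
      nlinarith [sq_nonneg ((S : ℤ) - 10 * (3 * m + 4))]
    have h3 : 9 * (3 * (m : ℤ) + 4) ^ 2 ≤ 169 * m ^ 2 := by nlinarith
    have h4 : 90 * b ^ 2 ≤ 99 * (S : ℤ) ^ 2 + 110 * 169 * m ^ 2 := by linarith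
    have h5 := mul_le_mul_of_nonneg_right h4 (show (0 : ℤ) ≤ m by lia)
    nlinarith
  have hpos : 0 < 6 * a - b ^ 2 := by
    refine pos_of_mul_pos_right (a := (m : ℤ)) ?_ (by lia)
    nlinarith
  have h5 : 5 * a < b ^ 2 + 2 * b + 6 := by
    refine lt_of_mul_lt_mul_left (a := (m : ℤ)) ?_ (by lia)
    -- The offset 4 in b ≥ S + 4 makes b - 3 ≥ S + 1.
    have h6 : ((S : ℤ) + 1) ^ 2 ≤ b * (b - 3) := by nlinarith
    have h7 := mul_le_mul_of_nonneg_right h6 (show (0 : ℤ) ≤ m by lia)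
    nlinarith
  obtain ⟨x, y, z, hxyz⟩ := sq_add_sq_add_three_sq (n := (6 * a - b ^ 2).toNat) (by lia)
  rw [Int.toNat_of_nonneg hpos.le] at hxyz
  obtain ⟨x₁, x₂, x₃, x₄, h1, h2, h3, h4, hsq, hsum⟩ :=
    exists_nonneg_of_representation (by lia) (by lia) hxyz h5
  lift x₁ to ℕ using h1
  lift x₂ to ℕ using h2
  lift x₃ to ℕ using h3
  lift x₄ to ℕ using h4
  refine ⟨x₁, x₂, x₃, x₄, ?_⟩
  zify
  have key : 2 * (N : ℤ) = 2 * (polygonal m x₁ + polygonal m x₂ + polygonal m x₃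
      + 3 * polygonal m x₄) := by
    linear_combination -hma + m * hsq - (m - 2) * hsum - two_mul_polygonal m x₁
      - two_mul_polygonal m x₂ - two_mul_polygonal m x₃ - 3 * two_mul_polygonal m x₄
  lia
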